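/- **Definitions.** A numerical polynomial is a polynomial $g\in\mathbb{Q}[x]$ with $g(q)\in\mathbb{Z}$ for every $q\in\mathbb{Z}$. Let $g$ be a numerical polynomial with $g(q)\ge 0$ for all sufficiently large $q\in\mathbb{N}=\{0,1,2,\ldots\}$, let $S=\{q\in\mathbb{N}: g(q)\ge 0\}$, and let $e:S\to\mathbb{N}\cup\{-1,\infty\}$. A *two-level polynomial of degree $g$ and depth $e$* is a sequence of polynomials $\{f_q\}_{q\in S}$ in $\mathbb{Q}[n]$, with $f_q$ of degree exactly $g(q)$, such that, writing $f_q(n)=\sum_{r=0}^{\infty}c_r(q)\,n^{g(q)-r}$ with $c_r(q)=0$ for $r>g(q)$, there exist polynomials $\phi_r\in\mathbb{Q}[x]$ $(r\ge 0)$ with $c_r(q)=\phi_r(q)$ for every $q\in S$ and every integer $r\ge 0$ with $r\le e(q)$. (For $q\in\mathbb{N}\setminus S$ one sets $f_q=0$ and $e(q)=-1$.) For $q\in\mathbb{N}$ let $P_q$ be the path with $q$ vertices, and for $k\in\mathbb{N}$ let $P_q^k$ be the Cartesian product of $k$ copies of $P_q$: its vertices are the $k$-tuples of vertices of $P_q$,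 and two tuples are adjacent if and only if they are adjacent in $P_q$ in one coordinate and equal in all other coordinates. For a finite graph $G$, let $\chi_G$ be its chromatic polynomial, the unique polynomial such that $\chi_G(n)$ is, for every $n\in\mathbb{N}$, the number of ways to color the vertices of $G$ with $n$ colors so that adjacent vertices receive different colors. **Theorem.** Fix $k\in\mathbb{N}$. Then the sequence $\{\chi_{P_q^k}(n)\}_{q\in\mathbb{N}}$ is a two-level polynomial of degree $g(q)=q^k$ and depth $e(q)=q$. (For $k=0$, $g$ is the constant polynomial $1$ and $P_q^0$ is a single vertex.) -/

import Mathlib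

open Polynomial

namespace SimpleGraph

/-- Maps to `Fin n` that are constant along the edges of `H` are counted by `n ^ c`, with `c` the
number of connected components of `H`. -/
theorem card_constant_on_edges {V : Type*} [Fintype V] (H : SimpleGraph V) (n : ℕ) :
    Nat.card {f : V → Fin n // ∀ u v, H.Adj u v → f u = f v} =
      n ^ Nat.card H.ConnectedComponent := by
  classical
  have key : ∀ f : V → Fin n, (∀ u v, H.Adj u v → f u = f v) →
      ∀ u v, H.Reachable u v → f u = f v := by
    rintro f hf u v ⟨p⟩
    induction p with
    | nil => rfl
    | cons h _ ih => exact (hf _ _ h).trans ih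
  let e : {f : V → Fin n // ∀ u v, H.Adj u v → f u = f v} ≃ (H.ConnectedComponent → Fin n) :=
    { toFun := fun f => Quot.lift f.1 (fun u v h => key f.1 f.2 u v h)
      invFun := fun F => ⟨fun v => F (H.connectedComponentMk v), fun u v h =>
        congrArg F (ConnectedComponent.sound h.reachable)⟩
      left_inv := fun f => rfl
      right_inv := fun F => by
        funext c
        induction c using Quot.ind
        rfl }
  rw [Nat.card_congr e, Nat.card_fun]
  simp

/-- The number of proper colourings of a finite graph with `n` colours is a polynomial in `n`. -/
theorem exists_chromaticPolynomial {V : Type*} [Fintype V] (G : SimpleGraph V) :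
    ∃ P : ℚ[X], ∀ n : ℕ, P.eval (n : ℚ) = Nat.card (G.Coloring (Fin n)) := by
  classical
  refine ⟨∑ A ∈ G.edgeFinset.powerset, (-1) ^ A.card *
    X ^ Nat.card (fromEdgeSet (A : Set (Sym2 V))).ConnectedComponent, fun n => ?_⟩
  let mono : (V → Fin n) → Sym2 V → Prop := fun f e => (e.map f).IsDiag
  have hcol : Nat.card (G.Coloring (Fin n)) =
      (Finset.univ.filter fun f : V → Fin n => ∀ e ∈ G.edgeFinset, ¬ mono f e).card := by
    rw [← Fintype.card_subtype, ← Nat.card_eq_fintype_card]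
    refine Nat.card_congr
      { toFun := fun C => ⟨C, ?_⟩
        invFun := fun f => Coloring.mk f.1 ?_
        left_inv := fun C => rfl
        right_inv := fun f => rfl }
    · intro e he
      induction e using Sym2.ind with
      | _ u v => simpa [mono] using C.valid (by simpa using he)
    · intro u v h
      simpa [mono] using f.2 s(u, v) (by simpa using h)
  have hA : ∀ A ∈ G.edgeFinset.powerset,
      (n : ℚ) ^ Nat.card (fromEdgeSet (A : Set (Sym2 V))).ConnectedComponent =
        ∑ f : V → Fin n, ∏ e ∈ A, (if mono f e then (1 : ℚ) else 0) := by
    intro A hA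
    rw [← Nat.cast_pow, ← card_constant_on_edges, Nat.card_eq_fintype_card, Fintype.card_subtype]
    have hprod : ∀ f : V → Fin n, ∏ e ∈ A, (if mono f e then (1 : ℚ) else 0) =
        if ∀ e ∈ A, mono f e then 1 else 0 := fun f => by
      rw [Finset.prod_ite_zero, Finset.prod_const_one]
      congr
    rw [Finset.sum_congr rfl fun f _ => hprod f, Finset.sum_boole]
    congr 2
    ext f
    simp only [Finset.mem_filter, Finset.mem_univ, true_and]
    constructor
    · intro h e he
      induction e using Sym2.ind with
      | _ u v =>
        by_cases huv : u = v
        · simp [mono, huv]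
        · simpa [mono] using h u v (by simp [he, huv])
    · intro h u v huv
      have := h s(u, v) (by simpa using ((fromEdgeSet_adj _).1 huv).1)
      simpa [mono] using this
  rw [hcol, eval_finsetSum]
  have hrhs : ((Finset.univ.filter fun f : V → Fin n => ∀ e ∈ G.edgeFinset, ¬ mono f e).card : ℚ) =
      ∑ f : V → Fin n, ∏ e ∈ G.edgeFinset, ((-if mono f e then (1 : ℚ) else 0) + 1) := by
    rw [← Finset.sum_boole]
    refine Finset.sum_congr rfl fun f _ => ?_
    have hprod : ∏ e ∈ G.edgeFinset, (if ¬ mono f e then (1 : ℚ) else 0) =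
        if ∀ e ∈ G.edgeFinset, ¬ mono f e then 1 else 0 := by
      rw [Finset.prod_ite_zero, Finset.prod_const_one]
      congr
    rw [← hprod]
    refine Finset.prod_congr rfl fun e _ => ?_
    by_cases h : mono f e <;> simp [h]
  rw [hrhs]
  simp only [Finset.prod_add_one]
  rw [Finset.sum_comm]
  refine Finset.sum_congr rfl fun A hA' => ?_
  have : (eval (n : ℚ) ((-1) ^ A.card *
    X ^ Nat.card (fromEdgeSet (A : Set (Sym2 V))).ConnectedComponent : ℚ[X])) =
    (-1) ^ A.card * (n : ℚ) ^ Nat.card (fromEdgeSet (A : Set (Sym2 V))).ConnectedComponent := by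
    simp
  rw [this, hA A hA', Finset.mul_sum]
  refine Finset.sum_congr rfl fun f _ => ?_
  rw [Finset.prod_neg]

/-- The chromatic polynomial `χ_G`: the (unique) polynomial whose value at every `n : ℕ` is the
number of proper vertex colourings of the finite graph `G` with `n` colours. -/
noncomputable def chromaticPolynomial {V : Type*} [Fintype V] (G : SimpleGraph V) : ℚ[X] :=
  G.exists_chromaticPolynomial.choose

theorem eval_chromaticPolynomial {V : Type*} [Fintype V] (G : SimpleGraph V) (n : ℕ) :
    G.chromaticPolynomial.eval (n : ℚ) = Nat.card (G.Coloring (Fin n)) :=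
  G.exists_chromaticPolynomial.choose_spec n

/-- The Cartesian product `G^k = G × ⋯ × G` of `k` copies of `G`: two `k`-tuples of vertices are
adjacent when they are adjacent in `G` in one coordinate and equal in all the others. -/
def cartesianPower {V : Type*} (G : SimpleGraph V) (k : ℕ) : SimpleGraph (Fin k → V) where
  Adj x y := ∃ i, G.Adj (x i) (y i) ∧ ∀ j, j ≠ i → x j = y j
  symm := ⟨fun _ _ ⟨i, h, h'⟩ => ⟨i, h.symm, fun j hj => (h' j hj).symm⟩⟩
  loopless := ⟨fun _ ⟨_, h, _⟩ => h.ne rfl⟩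

end SimpleGraph

/-- A numerical polynomial: a rational polynomial taking integer values at all integers. -/
def IsNumericalPolynomial (g : ℚ[X]) : Prop :=
  ∀ q : ℤ, ∃ z : ℤ, g.eval (q : ℚ) = z

/-- The codegree `r` coefficient of `p`: the coefficient of `n ^ (deg p - r)`, and `0` when
`r > deg p`. -/
noncomputable def codegreeCoeff (p : ℚ[X]) (r : ℕ) : ℚ :=
  if r ≤ p.natDegree then p.coeff (p.natDegree - r) else 0

/-- `f` is a two-level polynomial of degree `g` and depth `e`. Here `S = {q : 0 ≤ g q}`; the depth
takes values in `ℕ ∪ {-1, ∞}`, where `-1` is written `⊥` and `∞` is written `⊤`. Outside `S` the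
sequence is extended by `f q = 0` with `e q = -1`. -/
structure IsTwoLevelPolynomial (g : ℚ[X]) (e : ℕ → WithBot ℕ∞) (f : ℕ → ℚ[X]) : Prop where
  numerical : IsNumericalPolynomial g
  eventually_nonneg : ∀ᶠ q : ℕ in Filter.atTop, 0 ≤ g.eval (q : ℚ)
  degree_eq : ∀ q : ℕ, 0 ≤ g.eval (q : ℚ) →
    f q ≠ 0 ∧ ((f q).natDegree : ℚ) = g.eval (q : ℚ)
  coeff_eq : ∃ φ : ℕ → ℚ[X], ∀ q : ℕ, 0 ≤ g.eval (q : ℚ) →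
    ∀ r : ℕ, (r : WithBot ℕ∞) ≤ e q → codegreeCoeff (f q) r = (φ r).eval (q : ℚ)
  outside : ∀ q : ℕ, g.eval (q : ℚ) < 0 → f q = 0 ∧ e q = ⊥

/-! Write `c r` for the codegree `r` coefficient of the chromatic polynomial and collect these in a
power series with constant term 1. This series ignores isolated vertices and is multiplicative over
vertex-disjoint unions, so its logarithmic derivative, with coefficients `ℓ j`, is additive.

By Whitney's expansion, `c r` on a fixed vertex set is a linear combination of indicators "`G`
contains `A`" with `A` of rank `r`. Slice the vertices into layers by a height function. An edge set
of rank `r` crosses at most `r` gaps between consecutive layers, and this bound is compatible with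
products. Hence `ℓ j` is a combination of indicators of edge sets crossing at most `j` gaps
(`coeff_chromaticLogDeriv_mem_crossingFiltration`).

If there are more than `j` gaps, each such edge set misses one, so the alternating sum of `ℓ j` over
all ways of cutting gaps vanishes. Once a gap is cut, additivity kills the mixed difference obtained
by dropping the bottom layer, the top layer or both. Only the uncut term is left, so the mixed
difference of `ℓ j` itself is zero (`second_difference_eq_zero`). On grid boxes this says that `ℓ j`
is affine in each side length from `j` on, hence a polynomial in `q` on cubes of side `q ≥ j`. The
recurrence `r * c r = ∑ i < r, c i * ℓ (r - i)` then makes `c r` a polynomial in `q` for `q ≥ r`. -/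

theorem Polynomial.eq_of_forall_eval_natCast_eq {p q : ℚ[X]}
    (h : ∀ n : ℕ, p.eval (n : ℚ) = q.eval (n : ℚ)) : p = q :=
  eq_of_infinite_eval_eq p q <|
    (Set.infinite_range_of_injective Nat.cast_injective).mono <| by
      rintro _ ⟨n, rfl⟩
      exact h n

theorem codegreeCoeff_eq_coeff_reverse (p : ℚ[X]) (r : ℕ) :
    codegreeCoeff p r = p.reverse.coeff r := by
  rw [codegreeCoeff, coeff_reverse]
  split_ifs with h
  · rw [revAt_le h]
  · rw [revAt_eq_self_of_lt (not_le.1 h), coeff_eq_zero_of_natDegree_lt (not_le.1 h)]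

/-! ### Whitney's expansion, degree and leading coefficient. -/

namespace SimpleGraph

/-- Whitney's expansion of the chromatic polynomial over the spanning subgraphs. -/
theorem chromaticPolynomial_eq_sum {V : Type*} [Fintype V] [DecidableEq V] (G : SimpleGraph V)
    [DecidableRel G.Adj] :
    G.chromaticPolynomial = ∑ A ∈ G.edgeFinset.powerset, (-1) ^ A.card *
      X ^ Nat.card (fromEdgeSet (A : Set (Sym2 V))).ConnectedComponent := by
  refine eq_of_forall_eval_natCast_eq fun n => ?_
  rw [eval_chromaticPolynomial]
  let mono : (V → Fin n) → Sym2 V → Prop := fun f e => (e.map f).IsDiag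
  have hcol : Nat.card (G.Coloring (Fin n)) =
      (Finset.univ.filter fun f : V → Fin n => ∀ e ∈ G.edgeFinset, ¬ mono f e).card := by
    rw [← Fintype.card_subtype, ← Nat.card_eq_fintype_card]
    refine Nat.card_congr
      { toFun := fun C => ⟨C, ?_⟩
        invFun := fun f => Coloring.mk f.1 ?_
        left_inv := fun C => rfl
        right_inv := fun f => rfl }
    · intro e he
      induction e using Sym2.ind with
      | _ u v => simpa [mono] using C.valid (by simpa using he)
    · intro u v h
      simpa [mono] using f.2 s(u, v) (by simpa using h)
  have hA : ∀ A : Finset (Sym2 V),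
      (n : ℚ) ^ Nat.card (fromEdgeSet (A : Set (Sym2 V))).ConnectedComponent =
        ∑ f : V → Fin n, ∏ e ∈ A, (if mono f e then (1 : ℚ) else 0) := by
    intro A
    rw [← Nat.cast_pow, ← card_constant_on_edges, Nat.card_eq_fintype_card, Fintype.card_subtype]
    have hprod : ∀ f : V → Fin n, ∏ e ∈ A, (if mono f e then (1 : ℚ) else 0) =
        if ∀ e ∈ A, mono f e then 1 else 0 := fun f => by
      rw [Finset.prod_ite_zero, Finset.prod_const_one]
      congr
    rw [Finset.sum_congr rfl fun f _ => hprod f, Finset.sum_boole]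
    congr 2
    ext f
    simp only [Finset.mem_filter, Finset.mem_univ, true_and]
    constructor
    · intro h e he
      induction e using Sym2.ind with
      | _ u v =>
        by_cases huv : u = v
        · simp [mono, huv]
        · simpa [mono] using h u v (by simp [he, huv])
    · intro h u v huv
      have := h s(u, v) (by simpa using ((fromEdgeSet_adj _).1 huv).1)
      simpa [mono] using this
  have hrhs : ((Finset.univ.filter fun f : V → Fin n => ∀ e ∈ G.edgeFinset, ¬ mono f e).card : ℚ) =
      ∑ f : V → Fin n, ∏ e ∈ G.edgeFinset, ((-if mono f e then (1 : ℚ) else 0) + 1) := by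
    rw [← Finset.sum_boole]
    refine Finset.sum_congr rfl fun f _ => ?_
    have hprod : ∏ e ∈ G.edgeFinset, (if ¬ mono f e then (1 : ℚ) else 0) =
        if ∀ e ∈ G.edgeFinset, ¬ mono f e then 1 else 0 := by
      rw [Finset.prod_ite_zero, Finset.prod_const_one]
      congr
    rw [← hprod]
    refine Finset.prod_congr rfl fun e _ => ?_
    by_cases h : mono f e <;> simp [h]
  rw [hcol, eval_finsetSum, hrhs]
  simp only [Finset.prod_add_one]
  rw [Finset.sum_comm]
  refine Finset.sum_congr rfl fun A _ => ?_
  have : (eval (n : ℚ) ((-1) ^ A.card *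
    X ^ Nat.card (fromEdgeSet (A : Set (Sym2 V))).ConnectedComponent : ℚ[X])) =
    (-1) ^ A.card * (n : ℚ) ^ Nat.card (fromEdgeSet (A : Set (Sym2 V))).ConnectedComponent := by
    simp
  rw [this, hA A, Finset.mul_sum]
  refine Finset.sum_congr rfl fun f _ => ?_
  rw [Finset.prod_neg]

theorem card_connectedComponent_le {V : Type*} [Fintype V] (H : SimpleGraph V) :
    Nat.card H.ConnectedComponent ≤ Fintype.card V := by
  rw [← Nat.card_eq_fintype_card]
  exact Nat.card_le_card_of_surjective H.connectedComponentMk Quot.mk_surjective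

theorem eq_bot_of_card_connectedComponent {V : Type*} [Fintype V] (H : SimpleGraph V)
    (h : Nat.card H.ConnectedComponent = Fintype.card V) : H = ⊥ := by
  classical
  have hinj : Function.Injective H.connectedComponentMk := by
    have : Fintype H.ConnectedComponent := Fintype.ofFinite _
    refine ((Fintype.bijective_iff_surjective_and_card H.connectedComponentMk).2
      ⟨Quot.mk_surjective, ?_⟩).1
    rw [← h, Nat.card_eq_fintype_card]
  ext u v
  simp only [bot_adj, iff_false]
  exact fun huv => huv.ne (hinj (ConnectedComponent.sound huv.reachable))

theorem natDegree_chromaticPolynomial_le {V : Type*} [Fintype V] (G : SimpleGraph V) :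
    G.chromaticPolynomial.natDegree ≤ Fintype.card V := by
  classical
  rw [chromaticPolynomial_eq_sum]
  refine natDegree_sum_le_of_forall_le _ _ fun A _ => ?_
  have : ((-1) ^ A.card : ℚ[X]) = C ((-1) ^ A.card) := by simp
  rw [this]
  exact (natDegree_C_mul_X_pow_le _ _).trans (card_connectedComponent_le _)

theorem coeff_chromaticPolynomial {V : Type*} [Fintype V] [DecidableEq V] (G : SimpleGraph V)
    [DecidableRel G.Adj] (d : ℕ) :
    G.chromaticPolynomial.coeff d = ∑ A ∈ G.edgeFinset.powerset,
      if d = Nat.card (fromEdgeSet (A : Set (Sym2 V))).ConnectedComponent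
        then (-1) ^ A.card else 0 := by
  rw [chromaticPolynomial_eq_sum, finsetSum_coeff]
  refine Finset.sum_congr rfl fun A _ => ?_
  have : ((-1) ^ A.card : ℚ[X]) = C ((-1) ^ A.card) := by simp
  rw [this, coeff_C_mul_X_pow]

/-- Any edge merges two components, so in Whitney's expansion only the empty edge set has `|V|`
components. -/
theorem coeff_card_chromaticPolynomial {V : Type*} [Fintype V] (G : SimpleGraph V) :
    G.chromaticPolynomial.coeff (Fintype.card V) = 1 := by
  classical
  rw [coeff_chromaticPolynomial, Finset.sum_eq_single ∅]
  · rw [if_pos]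
    · simp
    · rw [Finset.coe_empty, fromEdgeSet_empty, ← Nat.card_eq_fintype_card]
      refine Nat.card_congr (Equiv.ofBijective _ ⟨fun u v h => ?_, Quot.mk_surjective⟩)
      exact reachable_bot.1 (ConnectedComponent.exact h)
  · intro A hA hne
    refine if_neg fun h => ?_
    obtain ⟨e, he⟩ := Finset.nonempty_iff_ne_empty.2 hne
    have heG := Finset.mem_powerset.1 hA he
    have hbot := eq_bot_of_card_connectedComponent _ h.symm
    induction e using Sym2.ind with
    | _ u v =>
      have : (fromEdgeSet (A : Set (Sym2 V))).Adj u v :=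
        (fromEdgeSet_adj _).2 ⟨he, ((mem_edgeFinset.1 heG : G.Adj u v)).ne⟩
      rw [hbot] at this
      exact this
  · simp

theorem natDegree_chromaticPolynomial {V : Type*} [Fintype V] (G : SimpleGraph V) :
    G.chromaticPolynomial.natDegree = Fintype.card V :=
  natDegree_eq_of_le_of_coeff_ne_zero G.natDegree_chromaticPolynomial_le
    (by rw [coeff_card_chromaticPolynomial]; exact one_ne_zero)

theorem leadingCoeff_chromaticPolynomial {V : Type*} [Fintype V] (G : SimpleGraph V) :
    G.chromaticPolynomial.leadingCoeff = 1 := by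
  rw [leadingCoeff, natDegree_chromaticPolynomial, coeff_card_chromaticPolynomial]

/-! ### Disjoint unions and isolated vertices. -/

/-- Both graphs live on all of `V`, so each carries isolated vertices; the power of `X` accounts for
them. In the bijection, two functions on `V` exchange their values off `W`. -/
theorem chromaticPolynomial_sup_mul {V : Type*} [Fintype V] (W : Set V) (G H : SimpleGraph V)
    (hG : ∀ u v, G.Adj u v → u ∈ W ∧ v ∈ W) (hH : ∀ u v, H.Adj u v → u ∉ W ∧ v ∉ W) :
    (G ⊔ H).chromaticPolynomial * X ^ Fintype.card V =
      G.chromaticPolynomial * H.chromaticPolynomial := by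
  classical
  refine eq_of_forall_eval_natCast_eq fun n => ?_
  rw [eval_mul, eval_mul, eval_pow, eval_X]
  simp only [eval_chromaticPolynomial]
  have hpow : n ^ Fintype.card V = Nat.card (V → Fin n) := by simp
  rw [← Nat.cast_pow, hpow, ← Nat.cast_mul, ← Nat.cast_mul, ← Nat.card_prod, ← Nat.card_prod]
  congr 1
  refine Nat.card_congr
    { toFun := fun c => (Coloring.mk (W.piecewise c.1 c.2) ?_, Coloring.mk (W.piecewise c.2 c.1) ?_)
      invFun := fun c => (Coloring.mk (W.piecewise c.1 c.2) ?_, W.piecewise c.2 c.1)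
      left_inv := ?_
      right_inv := ?_ }
  · intro u v h
    have := hG u v h
    simpa [this.1, this.2] using c.1.valid (Or.inl h)
  · intro u v h
    have := hH u v h
    simpa [this.1, this.2] using c.1.valid (Or.inr h)
  · rintro u v (h | h)
    · have := hG u v h
      simpa [this.1, this.2] using c.1.valid h
    · have := hH u v h
      simpa [this.1, this.2] using c.2.valid h
  · rintro ⟨c, d⟩
    refine Prod.ext (RelHom.ext fun v => ?_) (funext fun v => ?_) <;>
      by_cases hv : v ∈ W <;> simp [Coloring.mk, hv]
  · rintro ⟨c, d⟩
    refine Prod.ext (RelHom.ext fun v => ?_) (RelHom.ext fun v => ?_) <;>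
      by_cases hv : v ∈ W <;> simp [Coloring.mk, hv]

/-- Vertices outside the range of `f` are isolated and coloured freely. The bijection exchanges the
values on the range of `f` with those of a function on `W`. -/
theorem chromaticPolynomial_map_mul {V W : Type*} [Fintype V] [Fintype W] (f : W ↪ V)
    (G : SimpleGraph W) :
    (G.map f).chromaticPolynomial * X ^ Fintype.card W =
      G.chromaticPolynomial * X ^ Fintype.card V := by
  classical
  refine eq_of_forall_eval_natCast_eq fun n => ?_
  rw [eval_mul, eval_mul, eval_pow, eval_X, eval_pow, eval_X]
  simp only [eval_chromaticPolynomial]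
  have hV : n ^ Fintype.card V = Nat.card (V → Fin n) := by simp
  have hW : n ^ Fintype.card W = Nat.card (W → Fin n) := by simp
  rw [← Nat.cast_pow, ← Nat.cast_pow, hV, hW, ← Nat.cast_mul, ← Nat.cast_mul, ← Nat.card_prod,
    ← Nat.card_prod]
  congr 1
  refine Nat.card_congr
    { toFun := fun c => (Coloring.mk (fun w => c.1 (f w)) ?_, Function.extend f c.2 c.1)
      invFun := fun c => (Coloring.mk (Function.extend f c.1 c.2) ?_, fun w => c.2 (f w))
      left_inv := ?_
      right_inv := ?_ }
  · intro u v h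
    exact c.1.valid ((map_adj_apply).2 h)
  · intro u v h
    obtain ⟨a, b, hab, rfl, rfl⟩ := (map_adj _ _ _ _).1 h
    rw [f.injective.extend_apply, f.injective.extend_apply]
    exact c.1.valid hab
  · rintro ⟨c, d⟩
    refine Prod.ext (RelHom.ext fun v => ?_) (funext fun v => ?_)
    · by_cases hv : ∃ w, f w = v
      · obtain ⟨w, rfl⟩ := hv
        simp [Coloring.mk, f.injective.extend_apply]
      · simp [Coloring.mk, Function.extend_apply' _ _ _ hv]
    · simp [f.injective.extend_apply]
  · rintro ⟨c, d⟩
    refine Prod.ext (RelHom.ext fun v => ?_) (funext fun v => ?_)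
    · simp [Coloring.mk, f.injective.extend_apply]
    · by_cases hv : ∃ w, f w = v
      · obtain ⟨w, rfl⟩ := hv
        simp [Coloring.mk, f.injective.extend_apply]
      · simp [Coloring.mk, Function.extend_apply' _ _ _ hv]

/-! ### Edge-set indicators and crossings of gaps between layers. -/

/-- The indicator function of the graphs all of whose edges in `A` are present. -/
noncomputable def containsIndicator {V : Type*} (A : Set (Sym2 V)) : SimpleGraph V → ℚ :=
  open Classical in fun H => if A ⊆ H.edgeSet then 1 else 0

theorem containsIndicator_mul {V : Type*} (A B : Set (Sym2 V)) :
    containsIndicator A * containsIndicator B = containsIndicator (A ∪ B) := by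
  classical
  ext H
  simp only [Pi.mul_apply, containsIndicator, Set.union_subset_iff]
  by_cases hA : A ⊆ H.edgeSet <;> by_cases hB : B ⊆ H.edgeSet <;> simp [hA, hB]

/-- The indices `g < m` such that some edge in `A` goes from height `g` to height `g + 1`. -/
noncomputable def crossings {V : Type*} (h : V → ℕ) (m : ℕ) (A : Set (Sym2 V)) : Finset ℕ :=
  open Classical in (Finset.range m).filter fun g => ∃ u v, s(u, v) ∈ A ∧ h u = g ∧ h v = g + 1

theorem mem_crossings {V : Type*} {h : V → ℕ} {m : ℕ} {A : Set (Sym2 V)} {g : ℕ} :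
    g ∈ crossings h m A ↔ g < m ∧ ∃ u v, s(u, v) ∈ A ∧ h u = g ∧ h v = g + 1 := by
  simp [crossings]

theorem crossings_union {V : Type*} (h : V → ℕ) (m : ℕ) (A B : Set (Sym2 V)) :
    crossings h m (A ∪ B) = crossings h m A ∪ crossings h m B := by
  ext g
  simp only [Finset.mem_union, mem_crossings, Set.mem_union, or_and_right, exists_or, and_or_left]

/-- The number of crossings is at most the rank in the graphic matroid. -/
theorem card_crossings_add_card_connectedComponent_le {V : Type*} [Fintype V] (h : V → ℕ) (m : ℕ)
    (A : Set (Sym2 V)) :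
    (crossings h m A).card + Nat.card (fromEdgeSet A).ConnectedComponent ≤ Fintype.card V := by
  classical
  set L := crossings h m A
  set H := fromEdgeSet A
  have : Fintype H.ConnectedComponent := Fintype.ofFinite _
  -- The step functions of the crossed gaps, together with the functions constant on components, are
  -- linearly independent in `V → ℚ`; comparing dimensions gives the bound.
  let T : (L → ℚ) × (H.ConnectedComponent → ℚ) →ₗ[ℚ] (V → ℚ) :=
    { toFun := fun p v => (∑ g : L, p.1 g * if (g : ℕ) < h v then 1 else 0) +
        p.2 (H.connectedComponentMk v)
      map_add' := fun p p' => by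
        ext v
        simp only [Prod.fst_add, Prod.snd_add, Pi.add_apply, add_mul, Finset.sum_add_distrib]
        ring
      map_smul' := fun c p => by
        ext v
        simp only [Prod.smul_fst, Prod.smul_snd, Pi.smul_apply, smul_eq_mul, RingHom.id_apply,
          mul_add, Finset.mul_sum, mul_assoc] }
  have hT : Function.Injective T := by
    refine (injective_iff_map_eq_zero T).2 ?_
    rintro ⟨a, z⟩ h0
    have hv : ∀ v, (∑ g : L, a g * if (g : ℕ) < h v then 1 else 0) +
        z (H.connectedComponentMk v) = 0 := fun v => congrFun h0 v
    have ha : a = 0 := by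
      funext g
      obtain ⟨_, u, v, he, hu, hw⟩ := mem_crossings.1 g.2
      have hadj : H.Adj u v := (fromEdgeSet_adj _).2 ⟨he, by rintro rfl; omega⟩
      have hz : H.connectedComponentMk u = H.connectedComponentMk v :=
        ConnectedComponent.sound hadj.reachable
      have h1 := hv u
      have h2 := hv v
      rw [hz] at h1
      -- Along an edge crossing `g` the component part is constant, and only the step at `g`
      -- changes, which isolates `a g`.
      have h3 : ∑ g' : L, (a g' * (if (g' : ℕ) < h v then 1 else 0) -
          a g' * (if (g' : ℕ) < h u then 1 else 0)) = 0 := by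
        rw [Finset.sum_sub_distrib]
        linarith
      rw [Finset.sum_eq_single g] at h3
      · simpa [hu, hw] using h3
      · intro g' _ hne
        have hne' : (g' : ℕ) ≠ g := fun e => hne (Subtype.ext e)
        have : ((g' : ℕ) < h v) ↔ ((g' : ℕ) < h u) := by omega
        simp [this]
      · simp
    subst ha
    refine Prod.ext rfl (funext fun c => ?_)
    induction c using Quot.ind with
    | _ v =>
      have hz := hv v
      simp only [Pi.zero_apply, zero_mul, Finset.sum_const_zero, zero_add] at hz
      exact hz
  have := LinearMap.finrank_le_finrank_of_injective hT
  rw [Module.finrank_prod, Module.finrank_fintype_fun_eq_card, Module.finrank_fintype_fun_eq_card,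
    Module.finrank_fintype_fun_eq_card, Fintype.card_coe] at this
  rwa [Nat.card_eq_fintype_card]

/-- The graph invariants spanned by the indicators of edge sets with at most `j` crossings. -/
noncomputable def crossingFiltration {V : Type*} (h : V → ℕ) (m j : ℕ) :
    Submodule ℚ (SimpleGraph V → ℚ) :=
  Submodule.span ℚ (containsIndicator '' {A | (crossings h m A).card ≤ j})

theorem mul_mem_crossingFiltration {V : Type*} {h : V → ℕ} {m i j : ℕ} {F F' : SimpleGraph V → ℚ}
    (hF : F ∈ crossingFiltration h m i) (hF' : F' ∈ crossingFiltration h m j) :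
    F * F' ∈ crossingFiltration h m (i + j) := by
  have := Submodule.mul_mem_mul hF hF'
  rw [crossingFiltration, crossingFiltration, Submodule.span_mul_span] at this
  refine Submodule.span_mono ?_ this
  rintro _ ⟨_, ⟨A, hA, rfl⟩, _, ⟨B, hB, rfl⟩, rfl⟩
  refine ⟨A ∪ B, ?_, (containsIndicator_mul A B).symm⟩
  change (crossings h m (A ∪ B)).card ≤ i + j
  rw [crossings_union]
  exact (Finset.card_union_le _ _).trans (add_le_add hA hB)

/-- Delete the edges of `H` that cross some height in `S`. -/
def removeCrossings {V : Type*} (h : V → ℕ) (S : Finset ℕ) (H : SimpleGraph V) :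
    SimpleGraph V where
  Adj u v := H.Adj u v ∧ ∀ g ∈ S, ¬(h u = g ∧ h v = g + 1) ∧ ¬(h v = g ∧ h u = g + 1)
  symm := ⟨fun _ _ huv => ⟨huv.1.symm, fun g hg => (huv.2 g hg).symm⟩⟩
  loopless := ⟨fun _ huv => huv.1.ne rfl⟩

theorem removeCrossings_empty {V : Type*} (h : V → ℕ) (H : SimpleGraph V) :
    removeCrossings h ∅ H = H := by
  ext u v
  simp [removeCrossings]

theorem subset_edgeSet_removeCrossings {V : Type*} (h : V → ℕ) {m : ℕ} {S : Finset ℕ}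
    (hS : S ⊆ Finset.range m) (H : SimpleGraph V) (A : Set (Sym2 V)) :
    A ⊆ (removeCrossings h S H).edgeSet ↔ A ⊆ H.edgeSet ∧ Disjoint S (crossings h m A) := by
  constructor
  · refine fun hA => ⟨fun e he => ?_, Finset.disjoint_left.2 fun g hg hgA => ?_⟩
    · have := hA he
      induction e using Sym2.ind with
      | _ u v => exact this.1
    · obtain ⟨_, u, v, he, hu, hv⟩ := mem_crossings.1 hgA
      exact ((hA he).2 g hg).1 ⟨hu, hv⟩
  · rintro ⟨hA, hd⟩ e he
    have := hA he
    induction e using Sym2.ind with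
    | _ u v =>
      refine ⟨this, fun g hg => ⟨fun hc => ?_, fun hc => ?_⟩⟩
      · exact Finset.disjoint_left.1 hd hg
          (mem_crossings.2 ⟨Finset.mem_range.1 (hS hg), u, v, he, hc⟩)
      · exact Finset.disjoint_left.1 hd hg
          (mem_crossings.2 ⟨Finset.mem_range.1 (hS hg), v, u, Sym2.eq_swap ▸ he, hc⟩)

/-- For the indicator of an `A` contained in `H`, only the sets `S` of gaps not crossed by `A`
contribute. As `A` crosses at most `j < m` gaps, these are the subsets of a nonempty set, and their
signs cancel. -/
theorem sum_removeCrossings_eq_zero {V : Type*} {h : V → ℕ} {m j : ℕ} (hjm : j < m)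
    {F : SimpleGraph V → ℚ} (hF : F ∈ crossingFiltration h m j) (H : SimpleGraph V) :
    ∑ S ∈ (Finset.range m).powerset, (-1) ^ S.card * F (removeCrossings h S H) = 0 := by
  classical
  induction hF using Submodule.span_induction with
  | mem F hF =>
    obtain ⟨A, hA, rfl⟩ := hF
    change (crossings h m A).card ≤ j at hA
    by_cases hAH : A ⊆ H.edgeSet
    · set U := Finset.range m \ crossings h m A
      have hU : U.Nonempty := by
        refine Finset.sdiff_nonempty.2 fun hsub => ?_
        have := Finset.card_le_card hsub
        rw [Finset.card_range] at this
        omega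
      have hsub : U.powerset ⊆ (Finset.range m).powerset :=
        Finset.powerset_mono.2 Finset.sdiff_subset
      rw [← Finset.sum_subset hsub]
      · have h0 := Finset.sum_powerset_neg_one_pow_card_of_nonempty hU
        have h1 : ∑ S ∈ U.powerset, (-1 : ℚ) ^ S.card = 0 := by exact_mod_cast h0
        rw [← h1]
        refine Finset.sum_congr rfl fun S hS => ?_
        have hS' := Finset.subset_sdiff.1 (Finset.mem_powerset.1 hS)
        rw [containsIndicator,
          if_pos ((subset_edgeSet_removeCrossings h hS'.1 H A).2 ⟨hAH, hS'.2⟩), mul_one]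
      · intro S hS hSU
        have hS' := Finset.mem_powerset.1 hS
        rw [containsIndicator, if_neg, mul_zero]
        rw [subset_edgeSet_removeCrossings h hS']
        exact fun hd => hSU (Finset.mem_powerset.2 (Finset.subset_sdiff.2 ⟨hS', hd.2⟩))
    · refine Finset.sum_eq_zero fun S hS => ?_
      rw [containsIndicator, if_neg, mul_zero]
      rw [subset_edgeSet_removeCrossings h (Finset.mem_powerset.1 hS)]
      exact fun hd => hAH hd.1
  | zero => simp
  | add F F' _ _ h1 h2 => simp [mul_add, Finset.sum_add_distrib, h1, h2]
  | smul c F _ h1 =>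
    simp only [Pi.smul_apply, smul_eq_mul, mul_left_comm _ c]
    rw [← Finset.mul_sum, h1, mul_zero]

/-- Keep only the edges of `H` with both ends in `W`. -/
def restrictTo {V : Type*} (W : Set V) (H : SimpleGraph V) : SimpleGraph V where
  Adj u v := H.Adj u v ∧ u ∈ W ∧ v ∈ W
  symm := ⟨fun _ _ huv => ⟨huv.1.symm, huv.2.2, huv.2.1⟩⟩
  loopless := ⟨fun _ huv => huv.1.ne rfl⟩

/-- A graph invariant that is additive over vertex-disjoint unions. -/
def IsVertexDisjointAdditive {V : Type*} (F : SimpleGraph V → ℚ) : Prop :=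
  ∀ (W : Set V) (G H : SimpleGraph V), (∀ u v, G.Adj u v → u ∈ W ∧ v ∈ W) →
    (∀ u v, H.Adj u v → u ∉ W ∧ v ∉ W) → F (G ⊔ H) = F G + F H

/-- Edges change the height by at most one, so an edge from height at most `g` to height above `g`
must cross exactly the gap `g`, which has been cut. -/
theorem removeCrossings_restrictTo_eq_sup {V : Type*} {h : V → ℕ} {H : SimpleGraph V}
    (hH : ∀ u v, H.Adj u v → h u ≤ h v + 1) {S : Finset ℕ} {g : ℕ} (hg : g ∈ S) {s t : ℕ}
    (hs : s ≤ g + 1) (ht : g + 1 ≤ t) :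
    removeCrossings h S (H.restrictTo {v | s ≤ h v ∧ h v < t}) =
      removeCrossings h S (H.restrictTo {v | s ≤ h v ∧ h v < g + 1}) ⊔
        removeCrossings h S (H.restrictTo {v | g + 1 ≤ h v ∧ h v < t}) := by
  ext u v
  simp only [removeCrossings, restrictTo, sup_adj, Set.mem_ofPred_eq]
  constructor
  · rintro ⟨⟨hadj, hu, hv⟩, hc⟩
    have h1 := hH u v hadj
    have h2 := hH v u hadj.symm
    have h3 := hc g hg
    by_cases hlt : h u < g + 1
    · exact Or.inl ⟨⟨hadj, by omega, by omega⟩, hc⟩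
    · exact Or.inr ⟨⟨hadj, by omega, by omega⟩, hc⟩
  · rintro (⟨⟨hadj, hu, hv⟩, hc⟩ | ⟨⟨hadj, hu, hv⟩, hc⟩)
    · exact ⟨⟨hadj, by omega, by omega⟩, hc⟩
    · exact ⟨⟨hadj, by omega, by omega⟩, hc⟩

/-- An additive invariant of low crossing degree has vanishing second differences on slabs. -/
theorem second_difference_eq_zero {V : Type*} {h : V → ℕ} {m j : ℕ} (hjm : j < m)
    {F : SimpleGraph V → ℚ} (hF : F ∈ crossingFiltration h m j)
    (hadd : IsVertexDisjointAdditive F) {H : SimpleGraph V}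
    (hH : ∀ u v, H.Adj u v → h u ≤ h v + 1) :
    F (H.restrictTo {v | 0 ≤ h v ∧ h v < m + 1}) - F (H.restrictTo {v | 1 ≤ h v ∧ h v < m + 1}) -
      F (H.restrictTo {v | 0 ≤ h v ∧ h v < m}) + F (H.restrictTo {v | 1 ≤ h v ∧ h v < m}) = 0 := by
  set K : ℕ → ℕ → SimpleGraph V := fun s t => H.restrictTo {v | s ≤ h v ∧ h v < t} with hK
  set D : Finset ℕ → ℚ := fun S => F (removeCrossings h S (K 0 (m + 1))) -
    F (removeCrossings h S (K 1 (m + 1))) - F (removeCrossings h S (K 0 m)) +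
    F (removeCrossings h S (K 1 m)) with hD
  have hsum : ∑ S ∈ (Finset.range m).powerset, (-1) ^ S.card * D S = 0 := by
    simp only [hD, mul_add, mul_sub, Finset.sum_add_distrib, Finset.sum_sub_distrib,
      sum_removeCrossings_eq_zero hjm hF]
    simp
  have hzero : ∀ S ∈ (Finset.range m).powerset, S ≠ ∅ → (-1) ^ S.card * D S = 0 := by
    intro S hS hne
    obtain ⟨g, hg⟩ := Finset.nonempty_iff_ne_empty.2 hne
    have hgm := Finset.mem_range.1 (Finset.mem_powerset.1 hS hg)
    -- Each slab value becomes a term depending on `s` plus a term depending on `t`, so the mixed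
    -- difference in `s` and `t` cancels.
    have hsplit : ∀ s t, s ≤ g + 1 → g + 1 ≤ t → F (removeCrossings h S (K s t)) =
        F (removeCrossings h S (K s (g + 1))) + F (removeCrossings h S (K (g + 1) t)) := by
      intro s t hs ht
      rw [hK]
      dsimp only
      rw [removeCrossings_restrictTo_eq_sup hH hg hs ht]
      refine hadd {v | h v < g + 1} _ _ (fun u v huv => ?_) (fun u v huv => ?_)
      · exact ⟨huv.1.2.1.2, huv.1.2.2.2⟩
      · exact ⟨not_lt.2 huv.1.2.1.1, not_lt.2 huv.1.2.2.1⟩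
    rw [hD]
    dsimp only
    rw [hsplit 0 (m + 1) (by omega) (by omega), hsplit 1 (m + 1) (by omega) (by omega),
      hsplit 0 m (by omega) (by omega), hsplit 1 m (by omega) (by omega)]
    ring
  rw [Finset.sum_eq_single ∅ hzero (by simp)] at hsum
  simpa only [hD, removeCrossings_empty, Finset.card_empty, pow_zero, one_mul] using hsum

/-! ### The chromatic series and its logarithmic derivative. -/

/-- The power series `t ^ |V| χ_G(1 / t)`, whose coefficients are the codegree coefficients of the
chromatic polynomial. -/
noncomputable def chromaticSeries {V : Type*} [Fintype V] (G : SimpleGraph V) : PowerSeries ℚ :=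
  (G.chromaticPolynomial.reverse : PowerSeries ℚ)

theorem coeff_chromaticSeries {V : Type*} [Fintype V] (G : SimpleGraph V) (r : ℕ) :
    PowerSeries.coeff r G.chromaticSeries = codegreeCoeff G.chromaticPolynomial r := by
  rw [chromaticSeries, Polynomial.coeff_coe, codegreeCoeff_eq_coeff_reverse]

theorem coeff_zero_chromaticSeries {V : Type*} [Fintype V] (G : SimpleGraph V) :
    PowerSeries.coeff 0 G.chromaticSeries = 1 := by
  rw [chromaticSeries, Polynomial.coeff_coe, coeff_zero_reverse, leadingCoeff_chromaticPolynomial]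

theorem constantCoeff_chromaticSeries_ne_zero {V : Type*} [Fintype V] (G : SimpleGraph V) :
    PowerSeries.constantCoeff G.chromaticSeries ≠ 0 := by
  rw [← PowerSeries.coeff_zero_eq_constantCoeff_apply, coeff_zero_chromaticSeries]
  exact one_ne_zero

theorem _root_.Polynomial.reverse_X_pow (n : ℕ) : (X ^ n : ℚ[X]).reverse = 1 := by
  induction n with
  | zero => simp [← C_1, -map_one, reverse_C]
  | succ n ih =>
    rw [pow_succ, reverse_mul_of_domain, ih, one_mul]
    simpa [← C_1, -map_one, reverse_C] using reverse_mul_X (1 : ℚ[X])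

theorem chromaticSeries_sup {V : Type*} [Fintype V] (W : Set V) (G H : SimpleGraph V)
    (hG : ∀ u v, G.Adj u v → u ∈ W ∧ v ∈ W) (hH : ∀ u v, H.Adj u v → u ∉ W ∧ v ∉ W) :
    (G ⊔ H).chromaticSeries = G.chromaticSeries * H.chromaticSeries := by
  have := congrArg reverse (chromaticPolynomial_sup_mul W G H hG hH)
  rw [reverse_mul_of_domain, reverse_mul_of_domain, reverse_X_pow, mul_one] at this
  rw [chromaticSeries, this, Polynomial.coe_mul]
  rfl

theorem chromaticSeries_map {V W : Type*} [Fintype V] [Fintype W] (f : W ↪ V)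
    (G : SimpleGraph W) : (G.map f).chromaticSeries = G.chromaticSeries := by
  have := congrArg reverse (chromaticPolynomial_map_mul f G)
  rw [reverse_mul_of_domain, reverse_mul_of_domain, reverse_X_pow, reverse_X_pow, mul_one,
    mul_one] at this
  rw [chromaticSeries, this]
  rfl

/-- The logarithmic derivative `t χ' / χ` of the chromatic series. -/
noncomputable def chromaticLogDeriv {V : Type*} [Fintype V] (G : SimpleGraph V) : PowerSeries ℚ :=
  PowerSeries.X * PowerSeries.derivative ℚ G.chromaticSeries * G.chromaticSeries⁻¹

theorem chromaticLogDeriv_sup {V : Type*} [Fintype V] (W : Set V) (G H : SimpleGraph V)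
    (hG : ∀ u v, G.Adj u v → u ∈ W ∧ v ∈ W) (hH : ∀ u v, H.Adj u v → u ∉ W ∧ v ∉ W) :
    (G ⊔ H).chromaticLogDeriv = G.chromaticLogDeriv + H.chromaticLogDeriv := by
  have h1 := PowerSeries.mul_inv_cancel _ G.constantCoeff_chromaticSeries_ne_zero
  have h2 := PowerSeries.mul_inv_cancel _ H.constantCoeff_chromaticSeries_ne_zero
  simp only [chromaticLogDeriv]
  rw [chromaticSeries_sup W G H hG hH, PowerSeries.mul_inv_rev, Derivation.leibniz]
  simp only [smul_eq_mul]
  linear_combination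
    (PowerSeries.X * PowerSeries.derivative ℚ H.chromaticSeries * H.chromaticSeries⁻¹) * h1 +
    (PowerSeries.X * PowerSeries.derivative ℚ G.chromaticSeries * G.chromaticSeries⁻¹) * h2

theorem chromaticLogDeriv_map {V W : Type*} [Fintype V] [Fintype W] (f : W ↪ V)
    (G : SimpleGraph W) : (G.map f).chromaticLogDeriv = G.chromaticLogDeriv := by
  rw [chromaticLogDeriv, chromaticSeries_map]
  rfl

theorem coeff_zero_chromaticLogDeriv {V : Type*} [Fintype V] (G : SimpleGraph V) :
    PowerSeries.coeff 0 G.chromaticLogDeriv = 0 := by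
  rw [chromaticLogDeriv, mul_assoc, PowerSeries.coeff_zero_X_mul]

/-- A Newton-type recurrence, used in both directions: since the series has constant term 1 it
determines the logarithmic derivative, and since the latter has constant term 0 it determines the
series. -/
theorem natCast_mul_coeff_chromaticSeries {V : Type*} [Fintype V] (G : SimpleGraph V) (j : ℕ) :
    (j : ℚ) * PowerSeries.coeff j G.chromaticSeries =
      ∑ i ∈ Finset.range (j + 1), PowerSeries.coeff i G.chromaticSeries *
        PowerSeries.coeff (j - i) G.chromaticLogDeriv := by
  have h1 := PowerSeries.mul_inv_cancel _ G.constantCoeff_chromaticSeries_ne_zero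
  have h2 : G.chromaticSeries * G.chromaticLogDeriv =
      PowerSeries.X * PowerSeries.derivative ℚ G.chromaticSeries := by
    rw [chromaticLogDeriv]
    linear_combination (PowerSeries.X * PowerSeries.derivative ℚ G.chromaticSeries) * h1
  have h3 := congrArg (PowerSeries.coeff j) h2
  rw [PowerSeries.coeff_mul, Finset.Nat.sum_antidiagonal_eq_sum_range_succ
    (fun i l => PowerSeries.coeff i G.chromaticSeries * PowerSeries.coeff l G.chromaticLogDeriv)]
    at h3
  rw [h3]
  cases j with
  | zero => simp
  | succ j =>
    rw [PowerSeries.coeff_succ_X_mul, PowerSeries.coeff_derivative]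
    push_cast
    ring

/-- In Whitney's expansion the weight of `A` does not depend on the graph, and only edge sets with
`|V| - r` components, that is of rank `r`, occur. The rank bounds the number of crossings. For `r >
|V|` the coefficient is zero. -/
theorem coeff_chromaticSeries_mem_crossingFiltration {V : Type*} [Fintype V] (h : V → ℕ)
    (m r : ℕ) :
    (fun G : SimpleGraph V => PowerSeries.coeff r G.chromaticSeries) ∈
      crossingFiltration h m r := by
  classical
  by_cases hr : r ≤ Fintype.card V
  · have heq : (fun G : SimpleGraph V => PowerSeries.coeff r G.chromaticSeries) =
        ∑ A : Finset (Sym2 V),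
          (if Fintype.card V - r = Nat.card (fromEdgeSet (A : Set (Sym2 V))).ConnectedComponent
            then (-1 : ℚ) ^ A.card else 0) • containsIndicator (A : Set (Sym2 V)) := by
      ext G
      rw [coeff_chromaticSeries, codegreeCoeff, natDegree_chromaticPolynomial, if_pos hr,
        coeff_chromaticPolynomial, Finset.sum_apply,
        ← Finset.sum_subset (Finset.subset_univ G.edgeFinset.powerset)]
      · refine Finset.sum_congr rfl fun A hA => ?_
        have : (A : Set (Sym2 V)) ⊆ G.edgeSet := by
          simpa [← Finset.coe_subset] using Finset.mem_powerset.1 hA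
        simp [containsIndicator, this]
      · intro A _ hA
        have : ¬ (A : Set (Sym2 V)) ⊆ G.edgeSet := fun hAG =>
          hA (by simpa [← Finset.coe_subset] using hAG)
        simp [containsIndicator, this]
    rw [heq]
    refine Submodule.sum_mem _ fun A _ => ?_
    split_ifs with hc
    · refine Submodule.smul_mem _ _ (Submodule.subset_span ⟨_, ?_, rfl⟩)
      have := card_crossings_add_card_connectedComponent_le h m (A : Set (Sym2 V))
      change (crossings h m _).card ≤ r
      omega
    · rw [zero_smul]
      exact Submodule.zero_mem _
  · convert Submodule.zero_mem _ using 1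
    ext G
    rw [coeff_chromaticSeries, codegreeCoeff, natDegree_chromaticPolynomial, if_neg hr]
    rfl

theorem coeff_chromaticLogDeriv_mem_crossingFiltration {V : Type*} [Fintype V] (h : V → ℕ)
    (m j : ℕ) :
    (fun G : SimpleGraph V => PowerSeries.coeff j G.chromaticLogDeriv) ∈
      crossingFiltration h m j := by
  induction j using Nat.strong_induction_on with
  | _ j ih =>
    have heq : (fun G : SimpleGraph V => PowerSeries.coeff j G.chromaticLogDeriv) =
        (j : ℚ) • (fun G : SimpleGraph V => PowerSeries.coeff j G.chromaticSeries) -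
        -- The index is shifted by one because the term `i = 0` of the recurrence is the coefficient
        -- being solved for.
        ∑ i ∈ Finset.range j,
          (fun G : SimpleGraph V => PowerSeries.coeff (i + 1) G.chromaticSeries) *
          (fun G : SimpleGraph V => PowerSeries.coeff (j - (i + 1)) G.chromaticLogDeriv) := by
      ext G
      have := natCast_mul_coeff_chromaticSeries G j
      rw [Finset.sum_range_succ', coeff_zero_chromaticSeries] at this
      simp only [Pi.sub_apply, Pi.smul_apply, Finset.sum_apply, Pi.mul_apply, smul_eq_mul, this]
      simp
    rw [heq]
    refine Submodule.sub_mem _ (Submodule.smul_mem _ _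
      (coeff_chromaticSeries_mem_crossingFiltration h m j)) (Submodule.sum_mem _ fun i hi => ?_)
    have hij := Finset.mem_range.1 hi
    have := mul_mem_crossingFiltration (coeff_chromaticSeries_mem_crossingFiltration h m (i + 1))
      (ih (j - (i + 1)) (by omega))
    rwa [Nat.add_sub_cancel' (by omega)] at this

/-! ### Grid boxes and their slabs. -/

/-- The grid graph on the box with side lengths `b`. -/
def boxGraph {k : ℕ} (b : Fin k → ℕ) : SimpleGraph (∀ l, Fin (b l)) where
  Adj x y := ∃ i, ((x i : ℕ) + 1 = y i ∨ (y i : ℕ) + 1 = x i) ∧ ∀ l, l ≠ i → x l = y l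
  symm := ⟨fun _ _ ⟨i, h, h'⟩ => ⟨i, h.symm, fun l hl => (h' l hl).symm⟩⟩
  loopless := ⟨fun _ ⟨_, h, _⟩ => by omega⟩

theorem cartesianPower_pathGraph (k q : ℕ) :
    (pathGraph q).cartesianPower k = boxGraph fun _ : Fin k => q := by
  ext x y
  simp only [cartesianPower, boxGraph, pathGraph_adj]

/-- The translation by `s` in direction `i` from one box into another. -/
def boxShift {k : ℕ} {b b' : Fin k → ℕ} (i : Fin k) (s : ℕ)
    (h : ∀ l, b l + (if l = i then s else 0) ≤ b' l) : (∀ l, Fin (b l)) ↪ (∀ l, Fin (b' l)) where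
  toFun x l := ⟨x l + (if l = i then s else 0),
    lt_of_lt_of_le (Nat.add_lt_add_right (x l).2 _) (h l)⟩
  inj' x y hxy := by
    funext l
    have := congrArg Fin.val (congrFun hxy l)
    exact Fin.ext (Nat.add_right_cancel this)

theorem boxShift_apply_val {k : ℕ} {b b' : Fin k → ℕ} (i : Fin k) (s : ℕ)
    (h : ∀ l, b l + (if l = i then s else 0) ≤ b' l) (x : ∀ l, Fin (b l)) (l : Fin k) :
    (boxShift i s h x l : ℕ) = x l + if l = i then s else 0 := rfl

/-- Slabs of a large box are translates of smaller boxes. Since isolated vertices do not affect the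
logarithmic derivative, its values on slabs are its values on boxes. -/
theorem boxGraph_map_boxShift {k : ℕ} {b b' : Fin k → ℕ} (i : Fin k) {s t : ℕ}
    (h : ∀ l, b l + (if l = i then s else 0) ≤ b' l) (hne : ∀ l, l ≠ i → b l = b' l)
    (ht : t = b i + s) :
    (boxGraph b).map (boxShift i s h) =
      (boxGraph b').restrictTo {x | s ≤ (x i : ℕ) ∧ (x i : ℕ) < t} := by
  ext x y
  rw [map_adj]
  constructor
  · rintro ⟨u, v, ⟨l, hl, huv⟩, rfl, rfl⟩
    have hmem : ∀ w, s ≤ (boxShift i s h w i : ℕ) ∧ (boxShift i s h w i : ℕ) < t := by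
      intro w
      have := (w i).2
      rw [boxShift_apply_val, if_pos rfl]
      omega
    refine ⟨⟨l, ?_, fun a ha => ?_⟩, hmem u, hmem v⟩
    · rw [boxShift_apply_val, boxShift_apply_val]
      omega
    · exact Fin.ext (by rw [boxShift_apply_val, boxShift_apply_val, huv a ha])
  · have key : ∀ z : ∀ l, Fin (b' l), s ≤ (z i : ℕ) ∧ (z i : ℕ) < t →
        ∃ u, boxShift i s h u = z := by
      intro z hz
      refine ⟨fun l => ⟨z l - (if l = i then s else 0), ?_⟩, ?_⟩
      · by_cases hl : l = i
        · subst hl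
          rw [if_pos rfl]
          omega
        · rw [if_neg hl, hne l hl]
          exact (z l).2
      · funext l
        refine Fin.ext (Nat.sub_add_cancel ?_)
        by_cases hl : l = i
        · subst hl
          rw [if_pos rfl]
          exact hz.1
        · rw [if_neg hl]
          exact Nat.zero_le _
    rintro ⟨⟨l, hl, hxy⟩, hx, hy⟩
    obtain ⟨u, rfl⟩ := key x hx
    obtain ⟨v, rfl⟩ := key y hy
    refine ⟨u, v, ⟨l, ?_, fun a ha => ?_⟩, rfl, rfl⟩
    · rw [boxShift_apply_val, boxShift_apply_val] at hl
      omega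
    · have := congrArg Fin.val (hxy a ha)
      exact Fin.ext (Nat.add_right_cancel this)

/-- The order `j` coefficient of the logarithmic derivative for boxes is affine in each side length
that is at least `j`. -/
theorem coeff_chromaticLogDeriv_boxGraph_second_difference {k : ℕ} (j : ℕ) (i : Fin k)
    (b : Fin k → ℕ) (hj : j ≤ b i) :
    PowerSeries.coeff j (boxGraph (Function.update b i (b i + 2))).chromaticLogDeriv -
      2 * PowerSeries.coeff j (boxGraph (Function.update b i (b i + 1))).chromaticLogDeriv +
      PowerSeries.coeff j (boxGraph b).chromaticLogDeriv = 0 := by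
  set b₁ := Function.update b i (b i + 1) with hb₁
  set b₂ := Function.update b i (b i + 2) with hb₂
  have h₁ : b₁ i = b i + 1 := Function.update_self ..
  have h₂ : b₂ i = b i + 2 := Function.update_self ..
  have h₁' : ∀ l, l ≠ i → b₁ l = b l := fun l hl => Function.update_of_ne hl ..
  have h₂' : ∀ l, l ≠ i → b₂ l = b l := fun l hl => Function.update_of_ne hl ..
  -- The height is the coordinate `i`. The largest box has `b i + 2` layers, hence `m = b i + 1`
  -- gaps, which exceeds `j` exactly when `j ≤ b i`.
  have main := second_difference_eq_zero (h := fun x : ∀ l, Fin (b₂ l) => (x i : ℕ))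
    (Nat.lt_succ_of_le hj) (coeff_chromaticLogDeriv_mem_crossingFiltration _ _ j)
    (fun W G H hG hH => by
      simp only [chromaticLogDeriv_sup W G H hG hH, map_add]) (H := boxGraph b₂)
    (by
      rintro u v ⟨l, hl, huv⟩
      by_cases hli : l = i
      · subst hli
        omega
      · rw [huv i (Ne.symm hli)]
        omega)
  have restr : ∀ (c : Fin k → ℕ) (s t : ℕ), (∀ l, l ≠ i → c l = b₂ l) → c i + s ≤ b₂ i →
      t = c i + s → ((boxGraph b₂).restrictTo {x | s ≤ (x i : ℕ) ∧ (x i : ℕ) < t}).chromaticLogDeriv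
        = (boxGraph c).chromaticLogDeriv := by
    intro c s t hne hi ht
    have h : ∀ l, c l + (if l = i then s else 0) ≤ b₂ l := by
      intro l
      by_cases hl : l = i
      · subst hl
        simpa using hi
      · simp [hl, hne l hl]
    rw [← boxGraph_map_boxShift i h hne ht, chromaticLogDeriv_map]
  -- Dropping the bottom or the top layer gives the same box `b₁` up to translation, so the mixed
  -- difference becomes a second difference in the side length.
  rw [restr b₂ 0 _ (fun _ _ => rfl) (by omega) (by omega),
    restr b₁ 1 _ (fun l hl => by rw [h₁' l hl, h₂' l hl]) (by omega) (by omega),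
    restr b₁ 0 _ (fun l hl => by rw [h₁' l hl, h₂' l hl]) (by omega) (by omega),
    restr b 1 _ (fun l hl => by rw [h₂' l hl]) (by omega) (by omega)] at main
  linarith

end SimpleGraph

/-! ### From second differences to polynomials on the diagonal. -/

/-- A function that is affine in each coordinate beyond `j` is polynomial on the diagonal. -/
theorem exists_polynomial_of_second_difference (j : ℕ) : ∀ {k : ℕ} (Φ : (Fin k → ℕ) → ℚ),
    (∀ (i : Fin k) (b : Fin k → ℕ), j ≤ b i → Φ (Function.update b i (b i + 2)) -
      2 * Φ (Function.update b i (b i + 1)) + Φ b = 0) →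
    ∃ p : ℚ[X], ∀ q : ℕ, j ≤ q → Φ (fun _ => q) = p.eval (q : ℚ)
  | 0, Φ, _ => ⟨C (Φ 0), fun q _ => by
      rw [eval_C]
      exact congrArg Φ (Subsingleton.elim _ _)⟩
  | k + 1, Φ, hΦ => by
    -- The hypothesis bounds only the coordinate being varied, so the first coordinate can be frozen
    -- at any `a`.
    have hcons : ∀ a, ∃ p : ℚ[X], ∀ q : ℕ, j ≤ q →
        Φ (Fin.cons a fun _ : Fin k => q) = p.eval (q : ℚ) := fun a =>
      exists_polynomial_of_second_difference j (fun y : Fin k → ℕ => Φ (Fin.cons a y)) fun i b hb => by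
        have := hΦ i.succ (Fin.cons a b : Fin (k + 1) → ℕ) (by simpa using hb)
        rw [Fin.cons_succ, ← Fin.cons_update, ← Fin.cons_update] at this
        exact this
    have hstep : ∀ (y : Fin k → ℕ) (a : ℕ), j ≤ a → Φ (Fin.cons (a + 2) y) -
        2 * Φ (Fin.cons (a + 1) y) + Φ (Fin.cons a y) = 0 := by
      intro y a ha
      have := hΦ 0 (Fin.cons a y : Fin (k + 1) → ℕ) (by simpa using ha)
      rw [Fin.cons_zero, Fin.update_cons_zero, Fin.update_cons_zero] at this
      exact this
    -- Two consecutive values are carried through the induction because the recurrence has order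
    -- two.
    have haff : ∀ (y : Fin k → ℕ) (n : ℕ), Φ (Fin.cons (j + n) y) = Φ (Fin.cons j y) +
        n * (Φ (Fin.cons (j + 1) y) - Φ (Fin.cons j y)) ∧
        Φ (Fin.cons (j + n + 1) y) = Φ (Fin.cons j y) +
        (n + 1) * (Φ (Fin.cons (j + 1) y) - Φ (Fin.cons j y)) := by
      intro y n
      induction n with
      | zero => constructor <;> simp
      | succ n ih =>
        have := hstep y (j + n) (by omega)
        refine ⟨by rw [← add_assoc, ih.2]; push_cast; ring, ?_⟩
        rw [show j + (n + 1) + 1 = j + n + 2 by ring]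
        push_cast
        linear_combination this + 2 * ih.2 - ih.1
    obtain ⟨p, hp⟩ := hcons j
    obtain ⟨p', hp'⟩ := hcons (j + 1)
    -- Linear interpolation in the first coordinate from its values at `j` and `j + 1`.
    refine ⟨p + (X - C (j : ℚ)) * (p' - p), fun q hq => ?_⟩
    obtain ⟨n, rfl⟩ := Nat.exists_eq_add_of_le hq
    have hdiag : (fun _ : Fin (k + 1) => j + n) = Fin.cons (j + n) fun _ : Fin k => j + n := by
      funext l
      refine Fin.cases ?_ (fun l => ?_) l <;> simp
    rw [hdiag, (haff _ n).1, hp _ hq, hp' _ hq]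
    simp

theorem exists_polynomial_codegreeCoeff_chromaticPolynomial (k r : ℕ) :
    ∃ φ : ℚ[X], ∀ q : ℕ, r ≤ q →
      codegreeCoeff ((SimpleGraph.pathGraph q).cartesianPower k).chromaticPolynomial r =
        φ.eval (q : ℚ) := by
  choose ψ hψ using fun j => exists_polynomial_of_second_difference j
    (fun b : Fin k → ℕ => PowerSeries.coeff j (SimpleGraph.boxGraph b).chromaticLogDeriv)
    (SimpleGraph.coeff_chromaticLogDeriv_boxGraph_second_difference j)
  induction r using Nat.strong_induction_on with
  | _ r ih =>
    -- At `r = 0` the recurrence reads `0 = 0`, so monicity has to supply the coefficient.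
    rcases Nat.eq_zero_or_pos r with rfl | hr
    · refine ⟨1, fun q _ => ?_⟩
      rw [← SimpleGraph.coeff_chromaticSeries, SimpleGraph.coeff_zero_chromaticSeries, eval_one]
    · choose! φ hφ using ih
      -- The recurrence solved for the coefficient `r`. The inputs `i < r` and `r - i ≤ r` have
      -- thresholds at most `r`, so `q ≥ r` suffices for all of them.
      refine ⟨C (r : ℚ)⁻¹ * ∑ i ∈ Finset.range r, φ i * ψ (r - i), fun q hq => ?_⟩
      have hr0 : (r : ℚ) ≠ 0 := by exact_mod_cast hr.ne'
      rw [eval_mul, eval_C, eq_inv_mul_iff_mul_eq₀ hr0, ← SimpleGraph.coeff_chromaticSeries,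
        SimpleGraph.natCast_mul_coeff_chromaticSeries, Finset.sum_range_succ, Nat.sub_self,
        SimpleGraph.coeff_zero_chromaticLogDeriv, mul_zero, add_zero, eval_finsetSum]
      refine Finset.sum_congr rfl fun i hi => ?_
      have hir := Finset.mem_range.1 hi
      rw [eval_mul, ← hφ i hir q (by omega), ← hψ (r - i) q (by omega),
        ← SimpleGraph.coeff_chromaticSeries, SimpleGraph.cartesianPower_pathGraph]

theorem mainTheorem7 (k : ℕ) :
    IsTwoLevelPolynomial (X ^ k : ℚ[X]) (fun q : ℕ => (q : WithBot ℕ∞))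
      (fun q : ℕ => ((SimpleGraph.pathGraph q).cartesianPower k).chromaticPolynomial) := by
  have hnonneg : ∀ q : ℕ, 0 ≤ (X ^ k : ℚ[X]).eval (q : ℚ) := fun q => by
    rw [eval_pow, eval_X]
    positivity
  choose φ hφ using exists_polynomial_codegreeCoeff_chromaticPolynomial k
  refine ⟨fun q => ⟨q ^ k, by simp⟩, Filter.Eventually.of_forall hnonneg, fun q _ => ⟨?_, ?_⟩,
    ⟨φ, fun q _ r hr => hφ r q ?_⟩, fun q hq => absurd (hnonneg q) (not_le.2 hq)⟩
  · rw [← leadingCoeff_ne_zero, SimpleGraph.leadingCoeff_chromaticPolynomial]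
    exact one_ne_zero
  · rw [SimpleGraph.natDegree_chromaticPolynomial]
    simp
  · exact_mod_cast hr
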